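/- For complex $a,q$ let $(a;q)_n=\prod_{i=0}^{n-1}(1-aq^i)$ and, for $|q|<1$, $(a;q)_\infty=\lim_{n\to\infty}(a;q)_n$; write $(q)_n=(q;q)_n$, $(q)_\infty=(q;q)_\infty$, with the convention $1/(q)_n=0$ for $n<0$. Let ${a \brack b}_q=\frac{(q)_a}{(q)_b(q)_{a-b}}$ if $b\ge 0$ and $a-b\ge 0$, and ${a\brack b}_q=0$ otherwise; let $\left(\frac{j}{3}\right)$ be the Legendre symbol modulo $3$, and for $0<|q|<1$ and $z\neq 0$ let $$Q(q,z)=(q;q)_\infty(-z;q)_\infty(-q/z;q)_\infty\,(q/z^2;q^2)_\infty(z^2q;q^2)_\infty .$$ Put $\tilde q=q^2$, let $v\ge 1$ be an integer, and for $n_1,\dots,n_v\ge 0$ put $N_i=n_i+n_{i+1}+\cdots+n_v$. (1) For every integer $L\ge 0$ and every complex $q$ that is not a root of unity (so that, equivalently, the identity holds for an indeterminate $q$), $$\sum_{n_1,\ldots,n_v\geq 0} \frac{\tilde q^{\sum_{i=1}^v N_i(N_i+1)}}{(\tilde q)_{n_1}\cdots(\tilde q)_{n_{v-1}}(\tilde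 q)_{2n_v}}\cdot\frac{(q^3;q^6)_{n_v}}{(q;q^2)_{n_v+1}}\cdot\frac{(\tilde q)_{2L+1}}{(\tilde q)_{L-N_1}}=\sum_{j=-\infty}^\infty (-1)^j q^{(2v+1)j^2-2vj}\left(\frac{j+1}{3}\right){2L+1\brack L+j}_{\tilde q},$$ where only finitely many terms on either side are nonzero. (2) For every complex $q$ with $0<|q|<1$, $$\sum_{n_1,\ldots,n_v\geq 0} \frac{\tilde q^{\sum_{i=1}^v N_i(N_i+1)}}{(\tilde q)_{n_1}\cdots(\tilde q)_{n_{v-1}}(\tilde q)_{2n_v}}\cdot\frac{(q^3;q^6)_{n_v}}{(q;q^2)_{n_v+1}}=\frac{Q(q^{12v+6},q)}{(\tilde q)_\infty},$$ the series being absolutely convergent. (3) In particular (the case $v=1$, an identity of McLaughlin and Sills), for $0<|q|<1$, $$\sum_{n\ge 0}\frac{q^{2n(n+1)}(q^3;q^6)_n}{(q^2;q^2)_{2n}(q;q^2)_{n+1}}=\frac{Q(q^{18},q)}{(q^2;q^2)_\infty}.$$ -/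

import Mathlib

open Filter Topology

noncomputable section

/-- The `q`-Pochhammer symbol `(a;q)_n = (1-a)(1-aq)⋯(1-aq^{n-1})`. -/
def qPoch (a q : ℂ) (n : ℕ) : ℂ := ∏ i ∈ Finset.range n, (1 - a * q ^ i)

/-- `1/(q;q)_m` for an integer `m`, with the convention `1/(q;q)_m = 0` for `m < 0`. -/
def invQPoch (q : ℂ) (m : ℤ) : ℂ := if 0 ≤ m then 1 / qPoch q q m.toNat else 0

/-- The `q`-binomial coefficient with top entry `a` and bottom entry `b`:
`(q;q)_a / ((q;q)_b (q;q)_{a-b})` if `b ≥ 0` and `a - b ≥ 0`, and `0` otherwise. -/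
def qBinom (q : ℂ) (a b : ℤ) : ℂ :=
  if 0 ≤ b ∧ 0 ≤ a - b then
    qPoch q q a.toNat / (qPoch q q b.toNat * qPoch q q (a - b).toNat)
  else 0

/-- `(a;q)_∞ = lim_{n → ∞} (a;q)_n`, used for `|q| < 1`. -/
def qPochInf (a q : ℂ) : ℂ := limUnder atTop (fun n : ℕ => qPoch a q n)

/-- The limit that defines `(a;q)_∞` exists for `|q| < 1`. -/
theorem tendsto_qPoch (a : ℂ) {q : ℂ} (hq : ‖q‖ < 1) :
    Tendsto (fun n : ℕ => qPoch a q n) atTop (𝓝 (qPochInf a q)) := by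
  have hs : Summable (fun i : ℕ => ‖-(a * q ^ i)‖) := by
    simpa [norm_mul, norm_pow] using
      (summable_geometric_of_lt_one (norm_nonneg q) hq).mul_left ‖a‖
  have hm := (multipliable_one_add_of_summable hs).hasProd.tendsto_prod_nat
  refine tendsto_nhds_limUnder ⟨∏' i : ℕ, (1 + -(a * q ^ i)), ?_⟩
  simpa only [qPoch, sub_eq_add_neg] using hm

/-- The quintuple product
`Q(q,z) = (q, -z, -q/z; q)_∞ (q/z², z²q; q²)_∞`, used for `0 < |q| < 1` and `z ≠ 0`. -/
def quintQ (q z : ℂ) : ℂ :=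
  qPochInf q q * qPochInf (-z) q * qPochInf (-(q / z)) q *
    (qPochInf (q / z ^ 2) (q ^ 2) * qPochInf (z ^ 2 * q) (q ^ 2))

/-- `N_i = n_i + n_{i+1} + ⋯ + n_v`. The indices `1, …, v` are here `0, …, v - 1`. -/
def tailSum {v : ℕ} (n : Fin v → ℕ) (i : Fin v) : ℕ := ∑ k ∈ Finset.Ici i, n k

/-- The first index, for `n_1` and `N_1`. -/
def firstIdx {v : ℕ} (hv : 1 ≤ v) : Fin v := ⟨0, by omega⟩

/-- The last index, for `n_v`. -/
def lastIdx {v : ℕ} (hv : 1 ≤ v) : Fin v := ⟨v - 1, by omega⟩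

/-- The general term of the `v`-fold sum, with `q̃ = q²` and `(q̃)_m = (q̃;q̃)_m`:
`q̃^{∑ N_i(N_i+1)} / ((q̃)_{n_1} ⋯ (q̃)_{n_{v-1}} (q̃)_{2n_v}) · (q³;q⁶)_{n_v} / (q;q²)_{n_v+1}`. -/
def multiTerm {v : ℕ} (hv : 1 ≤ v) (q : ℂ) (n : Fin v → ℕ) : ℂ :=
  (q ^ 2) ^ (∑ i, tailSum n i * (tailSum n i + 1)) /
      ((∏ i ∈ Finset.Iio (lastIdx hv), qPoch (q ^ 2) (q ^ 2) (n i)) *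
        qPoch (q ^ 2) (q ^ 2) (2 * n (lastIdx hv))) *
    (qPoch (q ^ 3) (q ^ 6) (n (lastIdx hv)) / qPoch q (q ^ 2) (n (lastIdx hv) + 1))

/-- The general term of the finite version of level `L`: the term above times
`(q̃)_{2L+1} / (q̃)_{L-N_1}`. It vanishes for `N_1 > L`. -/
def finiteTerm {v : ℕ} (hv : 1 ≤ v) (L : ℕ) (q : ℂ) (n : Fin v → ℕ) : ℂ :=
  multiTerm hv q n *
    (qPoch (q ^ 2) (q ^ 2) (2 * L + 1) *
      invQPoch (q ^ 2) ((L : ℤ) - (tailSum n (firstIdx hv) : ℤ)))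

/-- The general term of the bilateral sum of the finite version:
`(-1)^j q^{(2v+1)j² - 2vj} ((j+1)/3) [2L+1, L+j]_{q̃}`. -/
def bilateralTerm (v L : ℕ) (q : ℂ) (j : ℤ) : ℂ :=
  (-1 : ℂ) ^ j * q ^ ((2 * (v : ℤ) + 1) * j ^ 2 - 2 * (v : ℤ) * j) *
    (legendreSym 3 (j + 1) : ℂ) * qBinom (q ^ 2) (2 * (L : ℤ) + 1) ((L : ℤ) + j)

end

/-! The proof is a Bailey chain relative to `a = q̃`. Let `β⁽⁰⁾_L = (q³;q⁶)_L / ((q̃)_{2L}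
(q;q²)_{L+1})` and `β⁽ᵛ⁺¹⁾_L = ∑_r q̃^{r(r+1)} β⁽ᵛ⁾_r / (q̃)_{L-r}` (`chainBeta`). This quantity has
two expansions. Unfolding the recursion with `r = N_1` gives the multisum over `n_1, …, n_v`
(`hasSum_multiTerm_mul`). Alternatively, `β⁽⁰⁾_L` is a bilateral sum over `j` with denominators
`(q̃)_{L+j} (q̃)_{L+1-j}`: a cube root of unity `ω` turns the Legendre symbol into a difference of
two finite triple products (`hasSum_chainTerm_zero`). Each step of the chain multiplies the `j`-th
coefficient by `q̃^{j²-j}`, by q-Chu–Vandermonde (`sum_bailey`, `hasSum_chainTerm`). Equating the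
expansions and multiplying by `(q̃)_{2L+1}` gives the finite identity.

For `|q| < 1`, dominated convergence as `L → ∞` applies to both expansions. The bilateral limit is
summed by the quintuple product identity (`hasSum_quintuple`), itself deduced from the triple
product, and one factor `1/(q̃)_∞` cancels. -/

theorem HasSum.of_eq {ι : Type*} {f g : ι → ℂ} {a b : ℂ} (h : HasSum f a)
    (hf : ∀ i, g i = f i) (hb : b = a) : HasSum g b := by
  rw [hb, funext hf]; exact h

theorem qPoch_zero (a q : ℂ) : qPoch a q 0 = 1 := by simp [qPoch]

theorem qPoch_succ (a q : ℂ) (n : ℕ) : qPoch a q (n + 1) = qPoch a q n * (1 - a * q ^ n) := by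
  simp [qPoch, Finset.prod_range_succ]

theorem qPoch_self_ne_zero {p : ℂ} (hp : ∀ m : ℕ, 1 ≤ m → p ^ m ≠ 1) (n : ℕ) :
    qPoch p p n ≠ 0 := by
  refine Finset.prod_ne_zero_iff.2 fun i _ h => hp (i + 1) (by omega) ?_
  linear_combination -h

theorem invQPoch_of_neg (p : ℂ) {m : ℤ} (hm : m < 0) : invQPoch p m = 0 :=
  if_neg (by omega)

theorem invQPoch_natCast (p : ℂ) (n : ℕ) : invQPoch p n = 1 / qPoch p p n := by
  simp [invQPoch]

theorem invQPoch_zero (p : ℂ) : invQPoch p 0 = 1 := by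
  simp [invQPoch, qPoch_zero]

/-- The recursion `1/(p)_{m-1} = (1 - p^m)/(p)_m`, valid for all integers `m`. -/
theorem invQPoch_sub_one {p : ℂ} (hp : ∀ m : ℕ, 1 ≤ m → p ^ m ≠ 1) (m : ℤ) :
    invQPoch p (m - 1) = (1 - p ^ m) * invQPoch p m := by
  rcases lt_trichotomy m 0 with h | rfl | h
  · simp [invQPoch_of_neg p h, invQPoch_of_neg p (show m - 1 < 0 by omega)]
  · rw [invQPoch_of_neg p (show (0 : ℤ) - 1 < 0 by omega)]; simp
  · obtain ⟨n, rfl⟩ : ∃ n : ℕ, m = (n + 1 : ℕ) := ⟨m.toNat - 1, by omega⟩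
    have e : ((n + 1 : ℕ) : ℤ) - 1 = n := by push_cast; ring
    have h1 := qPoch_self_ne_zero hp n
    have h2 := qPoch_self_ne_zero hp (n + 1)
    rw [e, invQPoch_natCast, invQPoch_natCast, zpow_natCast]
    rw [div_eq_iff h1, mul_assoc, one_div, inv_mul_eq_div, mul_div_assoc', eq_div_iff h2,
      qPoch_succ]
    ring

theorem pow_two_pow_ne_one {q : ℂ} (hq : ∀ m : ℕ, 1 ≤ m → q ^ m ≠ 1) (m : ℕ) (hm : 1 ≤ m) :
    (q ^ 2) ^ m ≠ 1 := by
  rw [← pow_mul]; exact hq _ (by omega)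

/-! ### Finite Jacobi triple product. -/

section FiniteTripleProduct

/-- The summand of the finite Jacobi triple product. -/
noncomputable def tripleTerm (q z : ℂ) (a b j : ℤ) : ℂ :=
  z ^ j * q ^ (j ^ 2) * (invQPoch (q ^ 2) (a + j) * invQPoch (q ^ 2) (b - j))

theorem tripleTerm_neg (q z : ℂ) (a b j : ℤ) :
    tripleTerm q z a b (-j) = tripleTerm q z⁻¹ b a j := by
  simp only [tripleTerm, zpow_neg, inv_zpow, neg_sq, sub_neg_eq_add, ← sub_eq_add_neg]
  ring

theorem HasSum.tripleTerm_swap {q z : ℂ} {a b : ℤ} {S : ℂ}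
    (h : HasSum (tripleTerm q z a b) S) : HasSum (tripleTerm q z⁻¹ b a) S := by
  rw [← (Equiv.neg ℤ).hasSum_iff] at h
  exact h.of_eq (fun j => (tripleTerm_neg q z a b j).symm) rfl

/-- With `w = q̃^{a+1+j}` and `u = q̃^{b-j}` the factor on the left is `1 - uw = (1 - w) + w(1 -
u)`; each bracket lowers the index of one reciprocal factorial. -/
theorem tripleTerm_step {q z : ℂ} (hq0 : q ≠ 0) (hz : z ≠ 0)
    (hq : ∀ m : ℕ, 1 ≤ m → q ^ m ≠ 1) (a b : ℕ) (j : ℤ) :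
    (1 - (q ^ 2) ^ (a + b + 1)) * tripleTerm q z (a + 1) b j =
      tripleTerm q z a b j + z⁻¹ * q ^ (2 * a + 1) * tripleTerm q z a b (j + 1) := by
  have hp := pow_two_pow_ne_one hq
  have h1 := invQPoch_sub_one hp ((a : ℤ) + 1 + j)
  have h2 := invQPoch_sub_one hp ((b : ℤ) - j)
  have e1 : (a : ℤ) + 1 + j - 1 = a + j := by ring
  have e2 : (a : ℤ) + (j + 1) = a + 1 + j := by ring
  have e3 : (b : ℤ) - (j + 1) = b - j - 1 := by ring
  rw [e1] at h1
  simp only [tripleTerm, e2, e3, h1, h2]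
  have hp0 : (q ^ 2 : ℂ) ≠ 0 := pow_ne_zero _ hq0
  have f1 : (q ^ 2) ^ (a + b + 1) = (q ^ 2) ^ ((a : ℤ) + 1 + j) * (q ^ 2) ^ ((b : ℤ) - j) := by
    rw [← zpow_add₀ hp0, ← zpow_natCast]; congr 1; push_cast; ring
  have f2 : q ^ (2 * a + 1) * q ^ ((j + 1) ^ 2) = q ^ (j ^ 2) * (q ^ 2) ^ ((a : ℤ) + 1 + j) := by
    rw [← zpow_natCast q 2, ← zpow_mul, ← zpow_natCast, ← zpow_add₀ hq0, ← zpow_add₀ hq0]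
    congr 1; push_cast; ring
  have f3 : z⁻¹ * z ^ (j + 1) = z ^ j := by
    rw [zpow_add_one₀ hz]; field_simp
  rw [f1]
  generalize invQPoch (q ^ 2) ((a : ℤ) + 1 + j) = A
  generalize invQPoch (q ^ 2) ((b : ℤ) - j) = B
  generalize (q ^ 2) ^ ((b : ℤ) - j) = u at *
  generalize (q ^ 2) ^ ((a : ℤ) + 1 + j) = w at *
  linear_combination (-(1 - u) * A * B * z⁻¹ * z ^ (j + 1)) * f2 -
    (1 - u) * A * B * q ^ (j ^ 2) * w * f3

theorem HasSum.tripleTerm_succ {q z : ℂ} (hq0 : q ≠ 0) (hz : z ≠ 0)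
    (hq : ∀ m : ℕ, 1 ≤ m → q ^ m ≠ 1) {a b : ℕ} {S : ℂ} (h : HasSum (tripleTerm q z a b) S) :
    HasSum (tripleTerm q z (a + 1 : ℕ) b)
      ((1 + z⁻¹ * q ^ (2 * a + 1)) * S / (1 - (q ^ 2) ^ (a + b + 1))) := by
  have hne : 1 - (q ^ 2) ^ (a + b + 1) ≠ 0 :=
    sub_ne_zero.2 (pow_two_pow_ne_one hq _ (by omega)).symm
  have h' := (h.add (((Equiv.addRight (1 : ℤ)).hasSum_iff.2 h).mul_left
    (z⁻¹ * q ^ (2 * a + 1)))).div_const (1 - (q ^ 2) ^ (a + b + 1))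
  refine h'.of_eq (fun j => ?_) (by ring)
  rw [eq_div_iff hne, mul_comm]
  push_cast
  exact tripleTerm_step hq0 hz hq a b j

/-- The finite form of the Jacobi triple product identity. -/
theorem hasSum_tripleTerm {q z : ℂ} (hq0 : q ≠ 0) (hz : z ≠ 0)
    (hq : ∀ m : ℕ, 1 ≤ m → q ^ m ≠ 1) (a b : ℕ) :
    HasSum (tripleTerm q z a b)
      (qPoch (-(q / z)) (q ^ 2) a * qPoch (-(z * q)) (q ^ 2) b /
        qPoch (q ^ 2) (q ^ 2) (a + b)) := by
  induction b generalizing a z with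
  | zero =>
    induction a with
    | zero =>
      convert hasSum_single (f := tripleTerm q z (0 : ℕ) (0 : ℕ)) (0 : ℤ) ?_ using 1
      · simp [tripleTerm, invQPoch_zero, qPoch_zero]
      · intro j hj
        rcases lt_or_gt_of_ne hj with h | h
        · simp [tripleTerm, invQPoch_of_neg _ h]
        · simp [tripleTerm, invQPoch_of_neg _ (neg_neg_of_pos h)]
    | succ a ih =>
      convert ih.tripleTerm_succ hq0 hz hq using 1
      simp only [qPoch_succ, qPoch_zero, add_zero]
      have e : q ^ 2 * (q ^ 2) ^ a = (q ^ 2) ^ (a + 1) := by ring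
      rw [e, ← div_div]
      congr 1
      ring
  | succ b ih =>
    -- The symmetry `j ↦ -j` exchanges `a` and `b` and inverts `z`, so the step in `a` also serves
    -- for `b`.
    have h := (((ih hz a).tripleTerm_swap).tripleTerm_succ hq0 (inv_ne_zero hz)
      hq).tripleTerm_swap
    rw [inv_inv] at h
    convert h using 1
    rw [← add_assoc, add_comm b a]
    simp only [qPoch_succ]
    have e : q ^ 2 * (q ^ 2) ^ (a + b) = (q ^ 2) ^ (a + b + 1) := by ring
    rw [e, ← div_div]
    congr 1
    rw [mul_div_assoc']
    congr 1
    ring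

end FiniteTripleProduct

/-! ### The q-Chu–Vandermonde sum. -/

section Vandermonde

/-- Splits `1 - xy = (1 - x) + x(1 - y)` with `x = p^s` and `y = p^{n+1-s}`. -/
theorem vandermonde_step {p : ℂ} (hp0 : p ≠ 0) (hp : ∀ m : ℕ, 1 ≤ m → p ^ m ≠ 1)
    (n : ℕ) (k s : ℤ) :
    (1 - p ^ (n + 1)) * (p ^ (s * (s + k)) * (invQPoch p s * invQPoch p (n + 1 - s) *
        invQPoch p (s + k))) =
      p ^ (s * (s + k)) * (invQPoch p (s - 1) * invQPoch p (n - (s - 1)) * invQPoch p (s + k)) +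
      p ^ (s * (s + (k + 1))) * (invQPoch p s * invQPoch p (n - s) * invQPoch p (s + k)) := by
  have h1 := invQPoch_sub_one hp s
  have h2 := invQPoch_sub_one hp (n + 1 - s)
  have e1 : (n : ℤ) + 1 - s - 1 = n - s := by ring
  have e2 : (n : ℤ) - (s - 1) = n + 1 - s := by ring
  rw [e1] at h2
  rw [e2, h1, h2]
  have f1 : p ^ (n + 1) = p ^ s * p ^ ((n : ℤ) + 1 - s) := by
    rw [← zpow_add₀ hp0, ← zpow_natCast]; congr 1; push_cast; ring
  have f2 : p ^ (s * (s + (k + 1))) = p ^ (s * (s + k)) * p ^ s := by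
    rw [← zpow_add₀ hp0]; congr 1; ring
  rw [f1, f2]
  ring

/-- A form of the `q`-Chu–Vandermonde sum. -/
theorem hasSum_vandermonde {p : ℂ} (hp0 : p ≠ 0) (hp : ∀ m : ℕ, 1 ≤ m → p ^ m ≠ 1)
    (n : ℕ) (k : ℤ) :
    HasSum (fun s : ℤ => p ^ (s * (s + k)) * (invQPoch p s * invQPoch p (n - s) *
      invQPoch p (s + k))) (invQPoch p n * invQPoch p (n + k)) := by
  induction n generalizing k with
  | zero =>
    convert hasSum_single (0 : ℤ) ?_ using 1
    · simp [invQPoch_zero]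
    · intro j hj
      rcases lt_or_gt_of_ne hj with h | h
      · simp [invQPoch_of_neg _ h]
      · simp [invQPoch_of_neg _ (neg_neg_of_pos h)]
  | succ n ih =>
    have hne : 1 - p ^ (n + 1) ≠ 0 := sub_ne_zero.2 (hp _ (by omega)).symm
    have hB : Summable fun s : ℤ => p ^ (s * (s + (k + 1))) *
        (invQPoch p s * invQPoch p (n - s) * invQPoch p (s + k)) := by
      refine summable_of_ne_finset_zero (s := Finset.Icc (0 : ℤ) n) fun s hs => ?_
      rw [Finset.mem_Icc, not_and_or, not_le, not_le] at hs
      rcases hs with hs | hs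
      · simp [invQPoch_of_neg p hs]
      · simp [invQPoch_of_neg p (show (n : ℤ) - s < 0 by omega)]
    -- The first part of the split is the `k + 1` summand minus the `hB` summand, both taken at `s -
    -- 1`; the second part is the `hB` summand at `s`. The unknown sum of `hB` therefore cancels.
    have h := (((Equiv.subRight (1 : ℤ)).hasSum_iff.2 ((ih (k + 1)).sub hB.hasSum)).add
      hB.hasSum).div_const (1 - p ^ (n + 1))
    refine h.of_eq (fun s => ?_) ?_
    · have h3 := vandermonde_step hp0 hp n k s
      rw [eq_div_iff hne, mul_comm]
      push_cast
      rw [h3]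
      simp only [Function.comp, Equiv.subRight_apply]
      congr 1
      have h4 := invQPoch_sub_one hp (s + k)
      have e1 : s - 1 + (k + 1) = s + k := by ring
      have e2 : s - 1 + k = s + k - 1 := by ring
      have f1 : p ^ (s * (s + k)) = p ^ ((s - 1) * (s + k)) * p ^ (s + k) := by
        rw [← zpow_add₀ hp0]; congr 1; ring
      rw [e1, e2, h4, f1]
      ring
    · have h3 : invQPoch p n = (1 - p ^ (n + 1)) * invQPoch p (n + 1 : ℕ) := by
        have := invQPoch_sub_one hp (n + 1 : ℕ)
        rwa [zpow_natCast, show ((n + 1 : ℕ) : ℤ) - 1 = n by push_cast; ring] at this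
      rw [eq_div_iff hne, sub_add_cancel, h3]
      push_cast
      rw [show (n : ℤ) + (k + 1) = n + 1 + k by ring]
      ring

end Vandermonde

/-! ### One step of the Bailey chain. -/

section BaileyStep

/-- The `a = p` Bailey lemma, applied to a single bilateral summand. -/
theorem sum_bailey {p : ℂ} (hp0 : p ≠ 0) (hp : ∀ m : ℕ, 1 ≤ m → p ^ m ≠ 1) (L : ℕ) (j : ℤ) :
    ∑ r ∈ Finset.range (L + 1), p ^ (r * (r + 1)) * invQPoch p ((L : ℤ) - r) *
        (invQPoch p (r + j) * invQPoch p (r + 1 - j)) =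
      p ^ (j ^ 2 - j) * (invQPoch p (L + j) * invQPoch p (L + 1 - j)) := by
  rcases lt_or_ge ((L : ℤ) + j) 0 with h | h
  · rw [invQPoch_of_neg p h]
    refine (Finset.sum_eq_zero fun r hr => ?_).trans (by ring)
    rw [Finset.mem_range] at hr
    rw [invQPoch_of_neg p (show (r : ℤ) + j < 0 by omega)]
    ring
  · obtain ⟨n, hn⟩ := Int.eq_ofNat_of_zero_le h
    -- Vandermonde with `n = L + j`, `k = 1 - 2j` and `s = r + j`; here `(r+j)(r+1-j) = r(r+1) - (j²
    -- - j)`.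
    have h1 := (hasSum_vandermonde hp0 hp n (1 - 2 * j)).mul_left (p ^ (j ^ 2 - j))
    have h2 := (Equiv.addRight j).hasSum_iff.2 h1
    rw [← Nat.cast_injective.hasSum_iff] at h2
    · rw [show (L : ℤ) + 1 - j = n + (1 - 2 * j) by omega, hn]
      refine HasSum.unique (hasSum_sum_of_ne_finset_zero fun r hr => ?_) (h2.of_eq (fun r => ?_) rfl)
      · rw [Finset.mem_range, not_lt] at hr
        rw [invQPoch_of_neg p (show (L : ℤ) - r < 0 by omega)]
        ring
      · simp only [Function.comp, Equiv.coe_addRight]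
        have e1 : (n : ℤ) - (r + j) = L - r := by omega
        have e2 : (r : ℤ) + j + (1 - 2 * j) = r + 1 - j := by ring
        have e3 : p ^ (r * (r + 1)) = p ^ (j ^ 2 - j) * p ^ (((r : ℤ) + j) * (r + 1 - j)) := by
          rw [← zpow_add₀ hp0, ← zpow_natCast]; congr 1; push_cast; ring
        rw [e1, e2, e3]
        ring
    -- For `r < 0` the indices `r + j` and `r + 1 - j` have negative sum `2r + 1`, so one factor
    -- vanishes.
    · intro r hr
      simp only [Function.comp, Equiv.coe_addRight]
      have hr0 : r < 0 := by
        by_contra h0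
        exact hr ⟨r.toNat, by simp; omega⟩
      rcases lt_or_ge (r + j) 0 with h3 | h3
      · rw [invQPoch_of_neg p h3]; ring
      · rw [invQPoch_of_neg p (show r + j + (1 - 2 * j) < 0 by omega)]; ring

end BaileyStep

/-! ### The initial Bailey pair and its iterates. -/

section BasePair

theorem legendreSym_three_of_mod {n r : ℤ} (h : n % 3 = r) :
    legendreSym 3 n = legendreSym 3 r := by
  rw [legendreSym.mod, Nat.cast_ofNat, h]

theorem legendreSym_three_mul (m : ℤ) : legendreSym 3 (3 * m) = 0 := by
  rw [legendreSym_three_of_mod (r := 0) (by omega)]; norm_num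

theorem legendreSym_three_mul_add_one (m : ℤ) : legendreSym 3 (3 * m + 1) = 1 := by
  rw [legendreSym_three_of_mod (r := 1) (by omega)]; norm_num

theorem legendreSym_three_mul_add_two (m : ℤ) : legendreSym 3 (3 * m + 2) = -1 := by
  rw [legendreSym_three_of_mod (r := 2) (by omega)]; norm_num

theorem Complex.exists_sq_add_self_add_one : ∃ w : ℂ, w ^ 2 + w + 1 = 0 := by
  have h := Complex.isPrimitiveRoot_exp 3 (by norm_num)
  generalize Complex.exp (2 * Real.pi * Complex.I / (3 : ℕ)) = w at h
  refine ⟨w, (mul_eq_zero.1 ?_).resolve_left (sub_ne_zero.2 (h.ne_one (by norm_num)))⟩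
  linear_combination h.pow_eq_one

/-- Fourier expansion of the character modulo 3; `w - w²` is its Gauss sum. -/
theorem legendreSym_three_mul_eq {w : ℂ} (hw : w ^ 2 + w + 1 = 0) (n : ℤ) :
    (legendreSym 3 n : ℂ) * (w - w ^ 2) = w ^ n - (w ^ 2) ^ n := by
  have h3 : w ^ 3 = 1 := by linear_combination (w - 1) * hw
  have hw0 : w ≠ 0 := by rintro rfl; simp at hw
  have hz : ∀ m : ℤ, w ^ (3 * m) = 1 := fun m => by
    rw [zpow_mul, show (3 : ℤ) = (3 : ℕ) by rfl, zpow_natCast, h3, one_zpow]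
  have hz2 : ∀ m : ℤ, (w ^ 2) ^ (3 * m) = 1 := fun m => by
    rw [← zpow_natCast, ← zpow_mul, mul_left_comm, hz]
  have hw2 : w ^ 2 ≠ 0 := pow_ne_zero _ hw0
  obtain ⟨m, h | h | h⟩ : ∃ m, n = 3 * m ∨ n = 3 * m + 1 ∨ n = 3 * m + 2 :=
    ⟨n / 3, by omega⟩
  · rw [h, legendreSym_three_mul, hz, hz2]; simp
  · rw [h, legendreSym_three_mul_add_one, zpow_add₀ hw0, zpow_add₀ hw2, hz, hz2]; simp
  · rw [h, legendreSym_three_mul_add_two, zpow_add₀ hw0, zpow_add₀ hw2, hz, hz2]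
    norm_cast
    push_cast
    linear_combination w * h3

theorem qPoch_cube {w : ℂ} (hw : w ^ 2 + w + 1 = 0) (q : ℂ) (n : ℕ) :
    qPoch (q ^ 3) (q ^ 6) n =
      qPoch q (q ^ 2) n * (qPoch (w ^ 2 * q) (q ^ 2) n * qPoch (w * q) (q ^ 2) n) := by
  simp only [qPoch, ← Finset.prod_mul_distrib]
  refine Finset.prod_congr rfl fun i _ => ?_
  have h3 : w ^ 3 = 1 := by linear_combination (w - 1) * hw
  have e : q ^ 3 * (q ^ 6) ^ i = (q * (q ^ 2) ^ i) ^ 3 := by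
    rw [mul_pow, ← pow_mul, ← pow_mul, ← pow_mul]; ring_nf
  rw [e, mul_assoc, mul_assoc]
  generalize q * (q ^ 2) ^ i = x
  linear_combination (x - x ^ 2) * hw + (x ^ 3 - x ^ 2) * h3

theorem qPoch_sq_ne_zero {q : ℂ} (hq : ∀ m : ℕ, 1 ≤ m → q ^ m ≠ 1) (n : ℕ) :
    qPoch q (q ^ 2) n ≠ 0 := by
  refine Finset.prod_ne_zero_iff.2 fun i _ h => hq (2 * i + 1) (by omega) ?_
  rw [pow_succ, pow_mul]
  linear_combination -h

/-- The `β`-sequence of the initial Bailey pair, and its iterates along the Bailey chain. -/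
noncomputable def chainBeta (q : ℂ) : ℕ → ℕ → ℂ
  | 0, L => qPoch (q ^ 3) (q ^ 6) L / (qPoch (q ^ 2) (q ^ 2) (2 * L) * qPoch q (q ^ 2) (L + 1))
  | v + 1, L => ∑ r ∈ Finset.range (L + 1),
      (q ^ 2) ^ (r * (r + 1)) * invQPoch (q ^ 2) ((L : ℤ) - r) * chainBeta q v r

/-- The summand of the bilateral expression of `chainBeta`. -/
noncomputable def chainTerm (q : ℂ) (v L : ℕ) (j : ℤ) : ℂ :=
  (-1 : ℂ) ^ j * q ^ ((2 * (v : ℤ) + 1) * j ^ 2 - 2 * (v : ℤ) * j) * (legendreSym 3 (j + 1) : ℂ) *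
    (invQPoch (q ^ 2) (L + j) * invQPoch (q ^ 2) (L + 1 - j))

/-- Expanding the Legendre symbol in powers of `ω` leaves finite triple products at `z = -ω` and `z
= -ω²`, with `a = L` and `b = L + 1`. -/
theorem hasSum_chainTerm_zero {q : ℂ} (hq0 : q ≠ 0) (hq : ∀ m : ℕ, 1 ≤ m → q ^ m ≠ 1) (L : ℕ) :
    HasSum (chainTerm q 0 L) (chainBeta q 0 L) := by
  obtain ⟨w, hw⟩ := Complex.exists_sq_add_self_add_one
  have h3 : w ^ 3 = 1 := by linear_combination (w - 1) * hw
  have hw0 : w ≠ 0 := by rintro rfl; simp at hw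
  have hw1 : w - w ^ 2 ≠ 0 := by
    intro h
    have : (w - w ^ 2) ^ 2 = -3 := by linear_combination (w ^ 2 - 3 * w + 3) * hw
    rw [h] at this; norm_num at this
  have hz1 : -w ≠ 0 := neg_ne_zero.2 hw0
  have hz2 : -w ^ 2 ≠ 0 := neg_ne_zero.2 (pow_ne_zero _ hw0)
  have h := (((hasSum_tripleTerm hq0 hz1 hq L (L + 1)).mul_left w).sub
    ((hasSum_tripleTerm hq0 hz2 hq L (L + 1)).mul_left (w ^ 2))).div_const (w - w ^ 2)
  refine h.of_eq (fun j => ?_) ?_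
  · have hl := legendreSym_three_mul_eq hw (j + 1)
    rw [zpow_add_one₀ hw0, zpow_add_one₀ (pow_ne_zero _ hw0)] at hl
    rw [eq_div_iff hw1]
    simp only [tripleTerm, chainTerm, neg_eq_neg_one_mul w, neg_eq_neg_one_mul (w ^ 2), mul_zpow]
    push_cast
    simp only [zero_mul, sub_zero, one_mul]
    linear_combination (-1 : ℂ) ^ j * q ^ (j ^ 2) *
      (invQPoch (q ^ 2) (L + j) * invQPoch (q ^ 2) (L + 1 - j)) * hl
  · have e1 : -(q / -w) = w ^ 2 * q := by
      field_simp; linear_combination -h3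
    have e2 : -(q / -w ^ 2) = w * q := by
      field_simp; linear_combination -h3
    have e3 : -(-w * q) = w * q := by ring
    have e4 : -(-w ^ 2 * q) = w ^ 2 * q := by ring
    have hA := qPoch_sq_ne_zero hq L
    have hA' := qPoch_sq_ne_zero hq (L + 1)
    have hB := qPoch_self_ne_zero (pow_two_pow_ne_one hq) (2 * L)
    have hB' := qPoch_self_ne_zero (pow_two_pow_ne_one hq) (L + (L + 1))
    rw [e1, e2, e3, e4, chainBeta, qPoch_cube hw]
    rw [show L + (L + 1) = 2 * L + 1 by ring] at *
    rw [qPoch_succ] at hA' hB'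
    rw [eq_div_iff hw1]
    simp only [qPoch_succ]
    generalize qPoch (w ^ 2 * q) (q ^ 2) L = P
    generalize qPoch (w * q) (q ^ 2) L = Q
    have e5 : q ^ 2 * (q ^ 2) ^ (2 * L) = (q * (q ^ 2) ^ L) ^ 2 := by ring
    rw [e5] at hB' ⊢
    have hx2 := right_ne_zero_of_mul hB'
    have hx1 := right_ne_zero_of_mul hA'
    rw [mul_assoc w, mul_assoc (w ^ 2)]
    generalize q * (q ^ 2) ^ L = x at *
    -- With `x = q^{2L+1}`, the two products combine through `ω(1 - ωx) - ω²(1 - ω²x) = (ω - ω²)(1 +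
    -- x)`. The factor `1 + x` cancels against `1 - x²`, leaving the last factor `1 - x` of
    -- `(q;q²)_{L+1}`.
    have hx3 : (1 - x ^ 2) = (1 - x) * (1 + x) := by ring
    rw [hx3] at hx2 ⊢
    have hx4 := right_ne_zero_of_mul hx2
    field_simp
    linear_combination -(P * Q * x) * h3

theorem hasSum_chainTerm {q : ℂ} (hq0 : q ≠ 0) (hq : ∀ m : ℕ, 1 ≤ m → q ^ m ≠ 1) (v L : ℕ) :
    HasSum (chainTerm q v L) (chainBeta q v L) := by
  induction v generalizing L with
  | zero => exact hasSum_chainTerm_zero hq0 hq L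
  | succ v ih =>
    have hp0 : q ^ 2 ≠ 0 := pow_ne_zero _ hq0
    have h := hasSum_sum (s := Finset.range (L + 1)) fun r _ =>
      (ih r).mul_left ((q ^ 2) ^ (r * (r + 1)) * invQPoch (q ^ 2) ((L : ℤ) - r))
    refine h.of_eq (fun j => ?_) rfl
    have hb := sum_bailey hp0 (pow_two_pow_ne_one hq) L j
    have e : q ^ ((2 * ((v + 1 : ℕ) : ℤ) + 1) * j ^ 2 - 2 * ((v + 1 : ℕ) : ℤ) * j) =
        q ^ ((2 * (v : ℤ) + 1) * j ^ 2 - 2 * (v : ℤ) * j) * (q ^ 2) ^ (j ^ 2 - j) := by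
      rw [← zpow_natCast q 2, ← zpow_mul, ← zpow_add₀ hq0]; congr 1; push_cast; ring
    simp only [chainTerm]
    refine Eq.trans (b := (-1 : ℂ) ^ j * q ^ ((2 * (v : ℤ) + 1) * j ^ 2 - 2 * (v : ℤ) * j) *
      (legendreSym 3 (j + 1) : ℂ) * ((q ^ 2) ^ (j ^ 2 - j) *
        (invQPoch (q ^ 2) (L + j) * invQPoch (q ^ 2) (L + 1 - j)))) (by rw [e]; ring) ?_
    rw [← hb, Finset.mul_sum]
    refine Finset.sum_congr rfl fun r _ => ?_
    ring

end BasePair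

/-! ### Unfolding the chain into the multiple sum. -/

section MultiSum

theorem tailSum_zero {v : ℕ} (a : ℕ) (n : Fin (v + 1) → ℕ) :
    tailSum (Fin.cons a n : Fin (v + 2) → ℕ) 0 = a + tailSum n 0 := by
  have h : ∀ k : ℕ, Finset.Ici (0 : Fin (k + 1)) = Finset.univ := fun k => by
    ext i; simp
  rw [tailSum, tailSum, h, h, Fin.sum_univ_succ]
  simp

theorem tailSum_succ {v : ℕ} (a : ℕ) (n : Fin (v + 1) → ℕ) (i : Fin (v + 1)) :
    tailSum (Fin.cons a n : Fin (v + 2) → ℕ) i.succ = tailSum n i := by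
  have h : Finset.Ici i.succ = (Finset.Ici i).map (Fin.succEmb _) := by
    ext k
    refine Fin.cases ?_ (fun k => ?_) k <;> simp
  rw [tailSum, tailSum, h, Finset.sum_map]
  simp

/-- A new front entry creates a new `N_1` and leaves the other tail sums unchanged, so it peels off
as one step of the chain. -/
theorem multiTerm_cons {v : ℕ} (q : ℂ) (a : ℕ) (n : Fin (v + 1) → ℕ) :
    multiTerm (Nat.succ_pos (v + 1)) q (Fin.cons a n : Fin (v + 2) → ℕ) =
      (q ^ 2) ^ ((a + tailSum n 0) * (a + tailSum n 0 + 1)) * invQPoch (q ^ 2) a *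
        multiTerm (Nat.succ_pos v) q n := by
  have h1 : lastIdx (Nat.succ_pos (v + 1)) = (lastIdx (Nat.succ_pos v)).succ := rfl
  have h2 : Finset.Iio (lastIdx (Nat.succ_pos v)).succ =
      Finset.cons 0 ((Finset.Iio (lastIdx (Nat.succ_pos v))).map (Fin.succEmb _)) (by simp) := by
    ext k
    refine Fin.cases ?_ (fun k => ?_) k <;> simp
  rw [multiTerm, multiTerm, h1, h2, Finset.prod_cons, Finset.prod_map, Fin.sum_univ_succ,
    invQPoch_natCast]
  simp only [tailSum_zero, tailSum_succ, Fin.cons_zero, Fin.cons_succ, Fin.coe_succEmb, pow_add]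
  ring

theorem le_tailSum_zero {v : ℕ} (n : Fin (v + 1) → ℕ) (i : Fin (v + 1)) : n i ≤ tailSum n 0 :=
  Finset.single_le_sum (f := n) (fun _ _ => Nat.zero_le _) (by simp)

theorem finite_tailSum_le (v L : ℕ) : {n : Fin (v + 1) → ℕ | tailSum n 0 ≤ L}.Finite :=
  (Set.finite_Iic (fun _ => L : Fin (v + 1) → ℕ)).subset fun n hn i =>
    (le_tailSum_zero n i).trans hn

theorem finite_support_multiTerm_mul (v L : ℕ) (q : ℂ) :
    (Function.support fun n : Fin (v + 1) → ℕ => multiTerm (Nat.succ_pos v) q n *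
      invQPoch (q ^ 2) ((L : ℤ) - tailSum n 0)).Finite := by
  refine (finite_tailSum_le v L).subset fun n hn => ?_
  by_contra h
  rw [Set.mem_ofPred_eq, not_le] at h
  exact hn (by simp only [invQPoch_of_neg _ (show (L : ℤ) - tailSum n 0 < 0 by omega), mul_zero])

/-- Reindexing by `r = a + t`, the value of `N_1` when the remaining tail sum is `t`; terms with `r
< t` vanish. -/
theorem hasSum_shift (q : ℂ) (L t : ℕ) :
    HasSum (fun a : ℕ => (q ^ 2) ^ ((a + t) * (a + t + 1)) * invQPoch (q ^ 2) a *
        invQPoch (q ^ 2) ((L : ℤ) - (a + t : ℕ)))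
      (∑ r ∈ Finset.range (L + 1), (q ^ 2) ^ (r * (r + 1)) * invQPoch (q ^ 2) ((L : ℤ) - r) *
        invQPoch (q ^ 2) ((r : ℤ) - t)) := by
  have h : HasSum (fun r : ℕ => (q ^ 2) ^ (r * (r + 1)) * invQPoch (q ^ 2) ((L : ℤ) - r) *
      invQPoch (q ^ 2) ((r : ℤ) - t)) _ :=
    hasSum_sum_of_ne_finset_zero (s := Finset.range (L + 1)) fun r hr => by
      rw [Finset.mem_range, not_lt] at hr
      rw [invQPoch_of_neg _ (show (L : ℤ) - r < 0 by omega)]; ring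
  rw [← (add_left_injective t).hasSum_iff] at h
  · refine h.of_eq (fun a => ?_) rfl
    simp only [Function.comp]
    push_cast
    rw [add_sub_cancel_right]
    ring
  · intro r hr
    have : r < t := by
      by_contra h0
      exact hr ⟨r - t, by simp; omega⟩
    rw [invQPoch_of_neg _ (show (r : ℤ) - t < 0 by omega), mul_zero]

theorem multiTerm_one (q : ℂ) (n : Fin 1 → ℕ) :
    multiTerm (Nat.succ_pos 0) q n = (q ^ 2) ^ (n 0 * (n 0 + 1)) * chainBeta q 0 (n 0) := by
  have h1 : tailSum n 0 = n 0 := by simp [tailSum]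
  have h2 : lastIdx (Nat.succ_pos 0) = 0 := rfl
  have h3 : Finset.Iio (0 : Fin 1) = ∅ := rfl
  simp only [multiTerm, h2, Fin.sum_univ_one, h1, h3, Finset.prod_empty, chainBeta]
  rw [one_mul, div_mul_div_comm, mul_div_assoc]

theorem hasSum_multiTerm_mul (v L : ℕ) (q : ℂ) :
    HasSum (fun n : Fin (v + 1) → ℕ => multiTerm (Nat.succ_pos v) q n *
      invQPoch (q ^ 2) ((L : ℤ) - tailSum n 0)) (chainBeta q (v + 1) L) := by
  induction v generalizing L with
  | zero =>
    rw [← (Equiv.funUnique (Fin 1) ℕ).symm.hasSum_iff, chainBeta]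
    refine HasSum.of_eq (hasSum_sum_of_ne_finset_zero (s := Finset.range (L + 1))
      (f := fun r : ℕ => (q ^ 2) ^ (r * (r + 1)) * invQPoch (q ^ 2) ((L : ℤ) - r) *
        chainBeta q 0 r) fun r hr => ?_) (fun r => ?_) rfl
    · rw [Finset.mem_range, not_lt] at hr
      rw [invQPoch_of_neg _ (show (L : ℤ) - r < 0 by omega)]; ring
    · simp only [Function.comp, multiTerm_one, Equiv.funUnique_symm_apply, uniqueElim_const,
        Fin.isValue]
      have h1 : tailSum (uniqueElim r : Fin 1 → ℕ) 0 = r := by simp [tailSum]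
      rw [h1]
      ring
  | succ v ih =>
    have hs : Summable fun n : Fin (v + 2) → ℕ => multiTerm (Nat.succ_pos (v + 1)) q n *
        invQPoch (q ^ 2) ((L : ℤ) - tailSum n 0) :=
      summable_of_hasFiniteSupport (finite_support_multiTerm_mul (v + 1) L q)
    -- The swap makes `n_1` the inner variable, summed with the tail fixed.
    have h1 := (Equiv.prodComm _ _).hasSum_iff.2
      ((Fin.consEquiv fun _ : Fin (v + 2) => ℕ).hasSum_iff.2 hs.hasSum)
    have h2 := h1.prod_fiberwise (g := fun n' : Fin (v + 1) → ℕ =>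
      ∑ r ∈ Finset.range (L + 1), (q ^ 2) ^ (r * (r + 1)) * invQPoch (q ^ 2) ((L : ℤ) - r) *
        (multiTerm (Nat.succ_pos v) q n' * invQPoch (q ^ 2) ((r : ℤ) - tailSum n' 0)))
      fun n' => by
        refine ((hasSum_shift q L (tailSum n' 0)).mul_left
          (multiTerm (Nat.succ_pos v) q n')).of_eq (fun a => ?_) ?_
        · simp only [Function.comp, Equiv.prodComm_apply, Prod.swap_prod_mk]
          erw [multiTerm_cons, tailSum_zero]
          ring
        · rw [Finset.mul_sum]
          refine Finset.sum_congr rfl fun r _ => by ring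
    have h3 := hasSum_sum (s := Finset.range (L + 1)) fun r _ =>
      (ih r).mul_left ((q ^ 2) ^ (r * (r + 1)) * invQPoch (q ^ 2) ((L : ℤ) - r))
    rw [chainBeta, ← h2.unique h3]
    exact hs.hasSum

end MultiSum

/-! ### The finite identity. -/

section FiniteIdentity

theorem qBinom_eq (q : ℂ) (L : ℕ) (j : ℤ) :
    qBinom q (2 * (L : ℤ) + 1) ((L : ℤ) + j) =
      qPoch q q (2 * L + 1) * (invQPoch q (L + j) * invQPoch q (L + 1 - j)) := by
  have e : 2 * (L : ℤ) + 1 - (L + j) = L + 1 - j := by ring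
  have e2 : (2 * (L : ℤ) + 1).toNat = 2 * L + 1 := by omega
  rw [qBinom, e, e2]
  split_ifs with h
  · rw [invQPoch, invQPoch, if_pos h.1, if_pos h.2, one_div_mul_one_div, mul_one_div]
  · rw [not_and_or, not_le, not_le] at h
    rcases h with h | h <;> simp [invQPoch_of_neg _ h]

theorem finite_support_finiteTerm {v : ℕ} (hv : 1 ≤ v) (L : ℕ) (q : ℂ) :
    (Function.support (finiteTerm hv L q)).Finite := by
  obtain ⟨v, rfl⟩ : ∃ k, v = k + 1 := ⟨v - 1, by omega⟩
  refine (finite_support_multiTerm_mul v L q).subset fun n hn h => hn ?_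
  have h' : multiTerm hv q n * invQPoch (q ^ 2) ((L : ℤ) - tailSum n (firstIdx hv)) = 0 := h
  rw [finiteTerm, mul_left_comm, h', mul_zero]

theorem finite_support_bilateralTerm (v L : ℕ) (q : ℂ) :
    (Function.support (bilateralTerm v L q)).Finite := by
  refine (Set.finite_Icc (-(L : ℤ)) (L + 1)).subset fun j hj => ?_
  by_contra h
  rw [Set.mem_Icc, not_and_or, not_le, not_le] at h
  refine hj ?_
  rw [bilateralTerm, qBinom_eq]
  rcases h with h | h
  · rw [invQPoch_of_neg _ (show (L : ℤ) + j < 0 by omega)]; ring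
  · rw [invQPoch_of_neg _ (show (L : ℤ) + 1 - j < 0 by omega)]; ring

theorem qPoch_base_zero (q : ℂ) (n : ℕ) : qPoch 0 q n = 1 := by simp [qPoch]

/-- The value `q = 0` is not a root of unity, yet the chain argument divides by powers of `q`. It is
treated apart: on each side only the zero index survives. -/
theorem finsum_finiteTerm_zero {v : ℕ} (hv : 1 ≤ v) (L : ℕ) :
    ∑ᶠ n : Fin v → ℕ, finiteTerm hv L 0 n = 1 := by
  rw [finsum_eq_single _ 0]
  · have h : ∀ i, tailSum (0 : Fin v → ℕ) i = 0 := fun i => by simp [tailSum]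
    have hL : invQPoch 0 (L : ℤ) = 1 := by rw [invQPoch_natCast, qPoch_base_zero, div_one]
    simp [finiteTerm, multiTerm, h, qPoch_base_zero, hL]
  · intro n hn
    obtain ⟨i, hi⟩ := Function.ne_iff.1 hn
    have h1 : n i ≤ tailSum n i :=
      Finset.single_le_sum (f := n) (fun _ _ => Nat.zero_le _) (by simp)
    have h2 : n i ≠ 0 := hi
    have h3 : ∑ i, tailSum n i * (tailSum n i + 1) ≠ 0 := by
      intro h
      have := Finset.sum_eq_zero_iff.1 h i (Finset.mem_univ i)
      rcases Nat.mul_eq_zero.1 this with h | h <;> omega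
    simp [finiteTerm, multiTerm, zero_pow h3]

theorem finsum_bilateralTerm_zero (v L : ℕ) : ∑ᶠ j : ℤ, bilateralTerm v L 0 j = 1 := by
  rw [finsum_eq_single _ 0]
  · rw [bilateralTerm, qBinom_eq]
    have h1 : (L : ℤ) + 1 - 0 = (L + 1 : ℕ) := by push_cast; ring
    rw [h1, add_zero, invQPoch_natCast, invQPoch_natCast]
    simp [qPoch_base_zero]
  · intro j hj
    have h : (2 * (v : ℤ) + 1) * j ^ 2 - 2 * (v : ℤ) * j ≠ 0 := by
      intro h
      have h1 : (2 * (v : ℤ) + 1) * j - 2 * v = 0 :=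
        (mul_eq_zero.1 (show j * ((2 * (v : ℤ) + 1) * j - 2 * v) = 0 by linarith)).resolve_left hj
      rcases lt_or_gt_of_ne hj with h2 | h2 <;> nlinarith [Int.natCast_nonneg v]
    simp [bilateralTerm, zero_zpow _ h]

theorem finsum_finiteTerm {v : ℕ} (hv : 1 ≤ v) {q : ℂ} (hq : ∀ m : ℕ, 1 ≤ m → q ^ m ≠ 1)
    (L : ℕ) : ∑ᶠ n : Fin v → ℕ, finiteTerm hv L q n = ∑ᶠ j : ℤ, bilateralTerm v L q j := by
  rcases eq_or_ne q 0 with rfl | hq0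
  · rw [finsum_finiteTerm_zero, finsum_bilateralTerm_zero]
  rw [← tsum_eq_finsum (L := .unconditional _) (finite_support_finiteTerm hv L q),
    ← tsum_eq_finsum (L := .unconditional _) (finite_support_bilateralTerm v L q)]
  have h2 := (hasSum_chainTerm hq0 hq v L).mul_left (qPoch (q ^ 2) (q ^ 2) (2 * L + 1))
  have h3 : HasSum (bilateralTerm v L q) _ := h2.of_eq
    (fun j => by rw [bilateralTerm, qBinom_eq, chainTerm]; ring) rfl
  rw [h3.tsum_eq]
  obtain ⟨v, rfl⟩ : ∃ k, v = k + 1 := ⟨v - 1, by omega⟩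
  have h1 := (hasSum_multiTerm_mul v L q).mul_left (qPoch (q ^ 2) (q ^ 2) (2 * L + 1))
  have h4 : HasSum (finiteTerm hv L q) _ := h1.of_eq
    (fun n => by rw [finiteTerm, mul_left_comm]; rfl) rfl
  exact h4.tsum_eq

end FiniteIdentity

/-! ### Limits and uniform bounds as `L → ∞`. -/

section Limits

theorem pow_ne_one_of_norm_lt_one {q : ℂ} (hq : ‖q‖ < 1) (m : ℕ) (hm : 1 ≤ m) : q ^ m ≠ 1 := by
  intro h
  have h1 := pow_lt_one₀ (norm_nonneg q) hq (by omega : m ≠ 0)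
  rw [← norm_pow, h, norm_one] at h1
  exact lt_irrefl _ h1

theorem qPochInf_ne_zero {a q : ℂ} (hq : ‖q‖ < 1) (h : ∀ i : ℕ, 1 - a * q ^ i ≠ 0) :
    qPochInf a q ≠ 0 := by
  have hs : Summable (fun i : ℕ => ‖-(a * q ^ i)‖) := by
    simpa [norm_mul, norm_pow] using
      (summable_geometric_of_lt_one (norm_nonneg q) hq).mul_left ‖a‖
  have hm := (multipliable_one_add_of_summable hs).hasProd.tendsto_prod_nat
  have h1 : Tendsto (fun n : ℕ => qPoch a q n) atTop (𝓝 (∏' i : ℕ, (1 + -(a * q ^ i)))) := by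
    simpa only [qPoch, sub_eq_add_neg] using hm
  rw [tendsto_nhds_unique (tendsto_qPoch a hq) h1]
  exact tprod_one_add_ne_zero_of_summable (fun i => by simpa [sub_eq_add_neg] using h i) hs

theorem qPochInf_self_ne_zero {q : ℂ} (hq : ‖q‖ < 1) : qPochInf q q ≠ 0 := by
  refine qPochInf_ne_zero hq fun i => ?_
  rw [← pow_succ', sub_ne_zero]
  exact (pow_ne_one_of_norm_lt_one hq _ (by omega)).symm

theorem Filter.Tendsto.exists_norm_le {f : ℕ → ℂ} {a : ℂ} (h : Tendsto f atTop (𝓝 a)) :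
    ∃ C, 0 ≤ C ∧ ∀ n, ‖f n‖ ≤ C := by
  obtain ⟨C, hC⟩ := (Metric.isBounded_range_of_tendsto f h).exists_norm_le
  exact ⟨C, (norm_nonneg _).trans (hC _ ⟨0, rfl⟩), fun n => hC _ ⟨n, rfl⟩⟩

theorem tendsto_invQPoch {p : ℂ} (hp : ‖p‖ < 1) (j : ℤ) :
    Tendsto (fun L : ℕ => invQPoch p (L + j)) atTop (𝓝 (qPochInf p p)⁻¹) := by
  have h1 := (tendsto_qPoch p hp).inv₀ (qPochInf_self_ne_zero hp)
  have h2 : Tendsto (fun L : ℕ => ((L : ℤ) + j).toNat) atTop atTop :=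
    tendsto_atTop.2 fun b => by
      filter_upwards [eventually_ge_atTop (b + j.natAbs)] with L hL
      omega
  refine (h1.comp h2).congr' ?_
  filter_upwards [eventually_ge_atTop j.natAbs] with L hL
  rw [invQPoch, if_pos (by omega), one_div, Function.comp]

theorem exists_norm_invQPoch_le {p : ℂ} (hp : ‖p‖ < 1) :
    ∃ C, 0 ≤ C ∧ ∀ m : ℤ, ‖invQPoch p m‖ ≤ C := by
  obtain ⟨C, hC, h⟩ := (tendsto_invQPoch hp 0).exists_norm_le
  refine ⟨C, hC, fun m => ?_⟩
  rcases lt_or_ge m 0 with hm | hm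
  · rwa [invQPoch_of_neg p hm, norm_zero]
  · have := h m.toNat
    rwa [add_zero, Int.toNat_of_nonneg hm] at this

theorem summable_zpow_mul_zpow_sq {x r : ℝ} (hx : 0 < x) (hr0 : 0 < r) (hr : r < 1) :
    Summable fun j : ℤ => x ^ j * r ^ (j ^ 2) := by
  have hl := Real.log_neg hr0 hr
  have hpi := Real.pi_pos
  -- Parameters chosen so that the theta majorant is `exp(j² log r + |j| |log x|)`.
  have h := summable_pow_mul_jacobiTheta₂_term_bound (|Real.log x| / (2 * Real.pi))
    (T := -Real.log r / Real.pi) (div_pos (neg_pos.2 hl) hpi) 0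
  refine Summable.of_nonneg_of_le (fun j => by positivity) (fun j => ?_) h
  rw [pow_zero, one_mul, ← Real.rpow_intCast, ← Real.rpow_intCast,
    Real.rpow_def_of_pos hx, Real.rpow_def_of_pos hr0, ← Real.exp_add, Real.exp_le_exp]
  have h1 : Real.log x * j ≤ |Real.log x| * |(j : ℝ)| := by
    rw [← abs_mul]; exact le_abs_self _
  push_cast
  field_simp
  nlinarith

end Limits

/-! ### Jacobi triple product as a limit of the finite form. -/

section TripleProduct

/-- The Jacobi triple product identity. -/
theorem hasSum_jacobi {s z : ℂ} (hs0 : s ≠ 0) (hs : ‖s‖ < 1) (hz : z ≠ 0) :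
    HasSum (fun j : ℤ => z ^ j * s ^ (j ^ 2))
      (qPochInf (s ^ 2) (s ^ 2) * (qPochInf (-(s / z)) (s ^ 2) * qPochInf (-(z * s)) (s ^ 2))) ∧
    Summable fun j : ℤ => ‖z ^ j * s ^ (j ^ 2)‖ := by
  have hsum : Summable fun j : ℤ => ‖z ^ j * s ^ (j ^ 2)‖ := by
    simpa [norm_mul, norm_zpow] using
      summable_zpow_mul_zpow_sq (norm_pos_iff.2 hz) (norm_pos_iff.2 hs0) hs
  refine ⟨?_, hsum⟩
  have hp : ‖s ^ 2‖ < 1 := by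
    rw [norm_pow]; exact pow_lt_one₀ (norm_nonneg s) hs two_ne_zero
  have hE := qPochInf_self_ne_zero hp
  obtain ⟨C, hC0, hC⟩ := exists_norm_invQPoch_le hp
  have h1 : Tendsto (fun L : ℕ => ∑' j : ℤ, tripleTerm s z L L j) atTop
      (𝓝 (∑' j : ℤ, z ^ j * s ^ (j ^ 2) *
        ((qPochInf (s ^ 2) (s ^ 2))⁻¹ * (qPochInf (s ^ 2) (s ^ 2))⁻¹))) := by
    refine tendsto_tsum_of_dominated_convergence (hsum.mul_right (C * C)) (fun j => ?_)
      (Eventually.of_forall fun L j => ?_)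
    · exact ((tendsto_invQPoch hp j).mul (tendsto_invQPoch hp (-j))).const_mul _
    · rw [tripleTerm, norm_mul, norm_mul (invQPoch _ _)]
      gcongr <;> apply hC
  have h2 : Tendsto (fun L : ℕ => qPoch (-(s / z)) (s ^ 2) L * qPoch (-(z * s)) (s ^ 2) L /
      qPoch (s ^ 2) (s ^ 2) (L + L)) atTop (𝓝 (qPochInf (-(s / z)) (s ^ 2) *
        qPochInf (-(z * s)) (s ^ 2) / qPochInf (s ^ 2) (s ^ 2))) :=
    ((tendsto_qPoch _ hp).mul (tendsto_qPoch _ hp)).div ((tendsto_qPoch _ hp).comp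
      (tendsto_atTop_mono (fun n => Nat.le_add_left n n) tendsto_id)) hE
  have h3 := tendsto_nhds_unique (h1.congr fun L => (hasSum_tripleTerm hs0 hz
    (pow_ne_one_of_norm_lt_one hs) L L).tsum_eq) h2
  rw [tsum_mul_right] at h3
  refine hsum.of_norm.hasSum.of_eq (fun _ => rfl) ?_
  field_simp at h3
  rw [h3, mul_comm z s, mul_assoc]

end TripleProduct

/-! ### Quintuple product identity. -/

section QuintupleProduct

theorem qPochInf_trisect {x : ℂ} (hx : ‖x‖ < 1) :
    qPochInf x x =
      qPochInf (x ^ 3) (x ^ 3) * (qPochInf x (x ^ 3) * qPochInf (x ^ 2) (x ^ 3)) := by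
  have hx3 : ‖x ^ 3‖ < 1 := by
    rw [norm_pow]; exact pow_lt_one₀ (norm_nonneg x) hx three_ne_zero
  have h1 : Tendsto (fun n : ℕ => qPoch x x (3 * n)) atTop (𝓝 (qPochInf x x)) :=
    (tendsto_qPoch x hx).comp (tendsto_atTop_mono (fun n => by simp; omega) tendsto_id)
  have h2 : ∀ n : ℕ, qPoch x x (3 * n) =
      qPoch (x ^ 3) (x ^ 3) n * (qPoch x (x ^ 3) n * qPoch (x ^ 2) (x ^ 3) n) := by
    intro n
    induction n with
    | zero => simp [qPoch_zero]
    | succ n ih =>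
      rw [show 3 * (n + 1) = 3 * n + 1 + 1 + 1 by ring]
      simp only [qPoch_succ]
      rw [ih]
      ring
  exact tendsto_nhds_unique (h1.congr h2)
    ((tendsto_qPoch _ hx3).mul ((tendsto_qPoch _ hx3).mul (tendsto_qPoch _ hx3)))

theorem neg_one_zpow_congr {a b : ℤ} (h : Even (a - b)) : (-1 : ℂ) ^ a = (-1) ^ b := by
  have h1 := h.neg_one_zpow (α := ℂ)
  rw [zpow_sub₀ (by norm_num)] at h1
  exact (div_eq_one_iff_eq (zpow_ne_zero _ (by norm_num))).1 h1

/-- Euler's pentagonal number theorem. -/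
theorem hasSum_pentagonal {s : ℂ} (hs0 : s ≠ 0) (hs : ‖s‖ < 1) :
    HasSum (fun n : ℤ => (-1 : ℂ) ^ n * s ^ (6 * n ^ 2 + 2 * n)) (qPochInf (s ^ 4) (s ^ 4)) := by
  have hs6 : ‖s ^ 6‖ < 1 := by
    rw [norm_pow]; exact pow_lt_one₀ (norm_nonneg s) hs (by norm_num)
  have hs4 : ‖s ^ 4‖ < 1 := by
    rw [norm_pow]; exact pow_lt_one₀ (norm_nonneg s) hs (by norm_num)
  refine (hasSum_jacobi (pow_ne_zero 6 hs0) hs6 (z := -s ^ 2)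
    (neg_ne_zero.2 (pow_ne_zero 2 hs0))).1.of_eq (fun n => ?_) ?_
  · rw [neg_eq_neg_one_mul (s ^ 2), mul_zpow, mul_assoc, ← zpow_natCast s 2, ← zpow_natCast s 6,
      ← zpow_mul, ← zpow_mul, ← zpow_add₀ hs0]
    congr 2; push_cast; ring
  · rw [qPochInf_trisect hs4]
    have e1 : -(s ^ 6 / -s ^ 2) = s ^ 4 := by field_simp
    have e2 : -(-s ^ 2 * s ^ 6) = (s ^ 4) ^ 2 := by ring
    have e3 : (s ^ 6) ^ 2 = (s ^ 4) ^ 3 := by ring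
    rw [e1, e2, e3]

/-- Modulo 3 in `j`: for `j = 3r` and `j = 3r + 1` the substitutions `n ↦ n - r` and `n ↦ r - n`
reduce the series to the pentagonal one. For `j = 3r + 2` the reflection `n ↦ 2r + 1 - n` preserves
the exponent and flips the sign, so the sum is zero. -/
theorem hasSum_quintuple_coeff {u : ℂ} (hu0 : u ≠ 0) (hu : ‖u‖ < 1) (j : ℤ) :
    HasSum (fun n : ℤ => (-1 : ℂ) ^ n * (u ^ 3) ^ (6 * n ^ 2 + (2 - 4 * j) * n))
      ((-1 : ℂ) ^ j * (legendreSym 3 (j + 1) : ℂ) * u ^ (-2 * (j ^ 2 - j)) *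
        qPochInf ((u ^ 3) ^ 4) ((u ^ 3) ^ 4)) := by
  have hs0 : u ^ 3 ≠ 0 := pow_ne_zero 3 hu0
  have hs : ‖u ^ 3‖ < 1 := by
    rw [norm_pow]; exact pow_lt_one₀ (norm_nonneg u) hu three_ne_zero
  have h1 : (-1 : ℂ) ≠ 0 := by norm_num
  have hu3 : ∀ k : ℤ, (u ^ 3) ^ k = u ^ (3 * k) := fun k => by
    rw [zpow_mul]; rfl
  have hp := hasSum_pentagonal hs0 hs
  obtain ⟨r, h | h | h⟩ : ∃ r, j = 3 * r ∨ j = 3 * r + 1 ∨ j = 3 * r + 2 := ⟨j / 3, by omega⟩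
  · rw [h, legendreSym_three_mul_add_one]
    refine (((Equiv.subRight r).hasSum_iff.2 hp).mul_left
      ((-1 : ℂ) ^ r * (u ^ 3) ^ (-6 * r ^ 2 + 2 * r))).of_eq (fun n => ?_) ?_
    · simp only [Function.comp, Equiv.subRight_apply]
      rw [mul_mul_mul_comm, ← zpow_add₀ h1, ← zpow_add₀ hs0]
      congr 2 <;> ring
    · rw [hu3, neg_one_zpow_congr (a := 3 * r) (b := r) ⟨r, by ring⟩, Int.cast_one, mul_one]
      congr 3; ring
  · rw [h, show 3 * r + 1 + 1 = 3 * r + 2 by ring, legendreSym_three_mul_add_two]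
    refine (((Equiv.subLeft r).hasSum_iff.2 hp).mul_left
      ((-1 : ℂ) ^ r * (u ^ 3) ^ (-6 * r ^ 2 - 2 * r))).of_eq (fun n => ?_) ?_
    · simp only [Function.comp, Equiv.subLeft_apply]
      rw [mul_mul_mul_comm, ← zpow_add₀ h1, ← zpow_add₀ hs0]
      congr 1
      · exact neg_one_zpow_congr ⟨n - r, by ring⟩
      · congr 1; ring
    · have e : u ^ (-2 * ((3 * r + 1) ^ 2 - (3 * r + 1))) = u ^ (3 * (-6 * r ^ 2 - 2 * r)) := by
        congr 1; ring
      rw [hu3, e, zpow_add_one₀ h1, neg_one_zpow_congr (a := 3 * r) (b := r) ⟨r, by ring⟩]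
      generalize qPochInf ((u ^ 3) ^ 4) ((u ^ 3) ^ 4) = E
      push_cast
      ring
  · rw [h, show 3 * r + 2 + 1 = 3 * (r + 1) by ring, legendreSym_three_mul]
    have hs6 : ‖(u ^ 3) ^ 6‖ < 1 := by
      rw [norm_pow]; exact pow_lt_one₀ (norm_nonneg _) hs (by norm_num)
    have hz : -(u ^ 3) ^ (2 - 4 * (3 * r + 2)) ≠ 0 := neg_ne_zero.2 (zpow_ne_zero _ hs0)
    obtain ⟨S, hS⟩ : ∃ S, HasSum (fun n : ℤ => (-1 : ℂ) ^ n *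
        (u ^ 3) ^ (6 * n ^ 2 + (2 - 4 * (3 * r + 2)) * n)) S := by
      refine ⟨_, (hasSum_jacobi (pow_ne_zero 6 hs0) hs6 hz).1.of_eq (fun n => ?_) rfl⟩
      rw [neg_eq_neg_one_mul ((u ^ 3) ^ _), mul_zpow, mul_assoc, ← zpow_natCast (u ^ 3) 6,
        ← zpow_mul, ← zpow_mul, ← zpow_add₀ hs0]
      congr 2; push_cast; ring
    have hS' := ((Equiv.subLeft (2 * r + 1)).hasSum_iff.2 hS).neg
    have hS0 : S = -S := hS.unique (hS'.of_eq (fun n => by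
      simp only [Function.comp, Equiv.subLeft_apply]
      have hn : (-1 : ℂ) ^ n = -(-1) ^ (2 * r + 1 - n) := by
        rw [neg_one_zpow_congr (b := 2 * r + 1 - n + 1) ⟨n - r - 1, by ring⟩, zpow_add_one₀ h1,
          mul_neg_one]
      rw [neg_mul_eq_neg_mul, hn]
      congr 2; ring) rfl)
    exact hS.of_eq (fun _ => rfl) (by rw [self_eq_neg.1 hS0]; simp)

theorem quintuple_fiber {u z : ℂ} (hu0 : u ≠ 0) (hz : z ≠ 0) (j n : ℤ) :
    (z / u ^ 3) ^ (j - 2 * n) * (u ^ 3) ^ ((j - 2 * n) ^ 2) *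
        ((-z ^ 2) ^ n * ((u ^ 3) ^ 2) ^ (n ^ 2)) =
      u ^ (3 * (j ^ 2 - j)) * z ^ j *
        ((-1 : ℂ) ^ n * (u ^ 3) ^ (6 * n ^ 2 + (2 - 4 * j) * n)) := by
  rw [div_zpow, neg_eq_neg_one_mul (z ^ 2), mul_zpow, div_eq_mul_inv, ← zpow_neg]
  have hu3 : ∀ k : ℤ, (u ^ 3) ^ k = u ^ (3 * k) := fun k => by
    rw [zpow_mul]; rfl
  have e1 : ((u ^ 3) ^ 2) ^ (n ^ 2) = u ^ (6 * n ^ 2) := by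
    rw [← pow_mul, zpow_mul]; rfl
  have e2 : z ^ (j - 2 * n) * (z ^ 2) ^ n = z ^ j := by
    rw [← zpow_natCast z 2, ← zpow_mul, ← zpow_add₀ hz]; congr 1; push_cast; ring
  have e3 : u ^ (3 * (j ^ 2 - j)) * u ^ (3 * (6 * n ^ 2 + (2 - 4 * j) * n)) =
      u ^ (3 * (-(j - 2 * n))) * u ^ (3 * (j - 2 * n) ^ 2) * u ^ (6 * n ^ 2) := by
    rw [← zpow_add₀ hu0, ← zpow_add₀ hu0, ← zpow_add₀ hu0]; congr 1; ring
  rw [hu3, hu3, hu3, e1, ← e2]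
  generalize u ^ (3 * (j ^ 2 - j)) = a at *
  generalize u ^ (3 * (6 * n ^ 2 + (2 - 4 * j) * n)) = b at *
  generalize u ^ (3 * (-(j - 2 * n))) = c at *
  generalize u ^ (3 * (j - 2 * n) ^ 2) = d at *
  generalize u ^ (6 * n ^ 2) = f at *
  generalize z ^ (j - 2 * n) = x
  generalize (z ^ 2) ^ n = y
  generalize (-1 : ℂ) ^ n = w
  linear_combination (-w * x * y) * e3

/-- The substitution `(j, n) ↦ (j - 2n, n)`. -/
def shearEquiv : ℤ × ℤ ≃ ℤ × ℤ where
  toFun x := (x.1 - 2 * x.2, x.2)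
  invFun x := (x.1 + 2 * x.2, x.2)
  left_inv x := by simp
  right_inv x := by simp

theorem HasSum.mul_of_summable_norm {f g : ℤ → ℂ} {a b : ℂ}
    (hf : HasSum f a ∧ Summable fun j => ‖f j‖) (hg : HasSum g b ∧ Summable fun j => ‖g j‖) :
    HasSum (fun x : ℤ × ℤ => f x.1 * g x.2) (a * b) :=
  hf.1.mul hg.1 (summable_mul_of_summable_norm hf.2 hg.2)

/-- Multiplies the triple products of bases `u⁶` and `u¹²`, in `z` and `-z²`, and collects the
coefficient of `z^j`. The product contains one surplus factor `(u¹²;u¹²)_∞`, which every coefficient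
also carries. -/
theorem hasSum_quintuple_mul {u z : ℂ} (hu0 : u ≠ 0) (hu : ‖u‖ < 1) (hz : z ≠ 0) :
    HasSum (fun j : ℤ => u ^ (3 * (j ^ 2 - j)) * z ^ j *
        ((-1 : ℂ) ^ j * (legendreSym 3 (j + 1) : ℂ) * u ^ (-2 * (j ^ 2 - j)) *
        qPochInf ((u ^ 3) ^ 4) ((u ^ 3) ^ 4)))
      (quintQ (u ^ 6) z * qPochInf ((u ^ 3) ^ 4) ((u ^ 3) ^ 4)) := by
  have hs0 : u ^ 3 ≠ 0 := pow_ne_zero 3 hu0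
  have hs : ‖u ^ 3‖ < 1 := by
    rw [norm_pow]; exact pow_lt_one₀ (norm_nonneg u) hu three_ne_zero
  have hs2 : ‖(u ^ 3) ^ 2‖ < 1 := by
    rw [norm_pow]; exact pow_lt_one₀ (norm_nonneg _) hs two_ne_zero
  have hA := hasSum_jacobi hs0 hs (div_ne_zero hz hs0)
  have hB := hasSum_jacobi (s := (u ^ 3) ^ 2) (z := -z ^ 2) (pow_ne_zero 2 hs0) hs2 (neg_ne_zero.2 (pow_ne_zero 2 hz))
  have h1 := shearEquiv.hasSum_iff.2 (HasSum.mul_of_summable_norm hA hB)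
  have h2 := h1.of_eq (g := fun x : ℤ × ℤ => u ^ (3 * (x.1 ^ 2 - x.1)) * z ^ x.1 *
    ((-1 : ℂ) ^ x.2 * (u ^ 3) ^ (6 * x.2 ^ 2 + (2 - 4 * x.1) * x.2)))
    (fun x => (quintuple_fiber hu0 hz x.1 x.2).symm) rfl
  have h3 := h2.prod_fiberwise fun j =>
    (hasSum_quintuple_coeff hu0 hu j).mul_left (u ^ (3 * (j ^ 2 - j)) * z ^ j)
  refine h3.of_eq (fun j => rfl) ?_
  have e1 : -(u ^ 3 / (z / u ^ 3)) = -(u ^ 6 / z) := by field_simp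
  have e2 : -(z / u ^ 3 * u ^ 3) = -z := by field_simp
  have e3 : -(u ^ 6 / -z ^ 2) = u ^ 6 / z ^ 2 := by field_simp
  have e4 : -(-z ^ 2 * u ^ 6) = z ^ 2 * u ^ 6 := by ring
  have e5 : (u ^ 3) ^ 4 = (u ^ 6) ^ 2 := by ring
  have e6 : (u ^ 3) ^ 2 = u ^ 6 := by ring
  rw [e5, e6, e1, e2, e3, e4, quintQ]
  generalize qPochInf (u ^ 6) (u ^ 6) = a1
  generalize qPochInf (-z) (u ^ 6) = a2
  generalize qPochInf (-(u ^ 6 / z)) (u ^ 6) = a3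
  generalize qPochInf (u ^ 6 / z ^ 2) ((u ^ 6) ^ 2) = a4
  generalize qPochInf (z ^ 2 * u ^ 6) ((u ^ 6) ^ 2) = a5
  generalize qPochInf ((u ^ 6) ^ 2) ((u ^ 6) ^ 2) = a6
  ring

/-- The quintuple product identity. -/
theorem hasSum_quintuple {u z : ℂ} (hu0 : u ≠ 0) (hu : ‖u‖ < 1) (hz : z ≠ 0) :
    HasSum (fun j : ℤ => (-1 : ℂ) ^ j * (legendreSym 3 (j + 1) : ℂ) * (u ^ (j ^ 2 - j) * z ^ j))
      (quintQ (u ^ 6) z) := by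
  have hs4 : ‖(u ^ 3) ^ 4‖ < 1 := by
    rw [← pow_mul, norm_pow]; exact pow_lt_one₀ (norm_nonneg _) hu (by norm_num)
  have hE := qPochInf_self_ne_zero hs4
  refine ((hasSum_quintuple_mul hu0 hu hz).div_const
    (qPochInf ((u ^ 3) ^ 4) ((u ^ 3) ^ 4))).of_eq (fun j => ?_) (mul_div_cancel_right₀ _ hE).symm
  have e3 : u ^ (j ^ 2 - j) = u ^ (3 * (j ^ 2 - j)) * u ^ (-2 * (j ^ 2 - j)) := by
    rw [← zpow_add₀ hu0]; congr 1; ring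
  rw [eq_div_iff hE, e3]
  generalize qPochInf ((u ^ 3) ^ 4) ((u ^ 3) ^ 4) = E
  ring

end QuintupleProduct

/-! ### The infinite series. -/

section InfiniteHierarchy

theorem exists_norm_chainBeta_zero_le {q : ℂ} (hq : ‖q‖ < 1) :
    ∃ C, 0 ≤ C ∧ ∀ n, ‖chainBeta q 0 n‖ ≤ C := by
  have hlt : ∀ k : ℕ, k ≠ 0 → ‖q ^ k‖ < 1 := fun k hk => by
    rw [norm_pow]; exact pow_lt_one₀ (norm_nonneg q) hq hk
  have hp := hlt 2 two_ne_zero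
  have h1 := tendsto_qPoch (q ^ 3) (hlt 6 (by norm_num))
  have h2 := (tendsto_qPoch (q ^ 2) hp).comp
    (tendsto_atTop_mono (fun n : ℕ => (by omega : n ≤ 2 * n)) tendsto_id)
  have h3 := (tendsto_qPoch q hp).comp (tendsto_add_atTop_nat 1)
  refine (h1.div (h2.mul h3) (mul_ne_zero (qPochInf_self_ne_zero hp)
    (qPochInf_ne_zero hp fun i h => ?_))).exists_norm_le
  refine pow_ne_one_of_norm_lt_one hq (2 * i + 1) (by omega) ?_
  rw [pow_succ, pow_mul]
  linear_combination -h

/-- By induction on the depth: since `N_1(N_1+1) ≥ n_1`, the new factor is bounded by a geometric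
term in `n_1` alone, and the majorant is a product. -/
theorem summable_norm_multiTerm {q : ℂ} (hq : ‖q‖ < 1) (v : ℕ) :
    Summable fun n : Fin (v + 1) → ℕ => ‖multiTerm (Nat.succ_pos v) q n‖ := by
  have hp : ‖q ^ 2‖ < 1 := by
    rw [norm_pow]; exact pow_lt_one₀ (norm_nonneg q) hq two_ne_zero
  have hpow : ∀ a k : ℕ, a ≤ k → ‖q ^ 2‖ ^ k ≤ ‖q ^ 2‖ ^ a := fun a k h =>
    pow_le_pow_of_le_one (norm_nonneg _) hp.le h
  have hgeo := summable_geometric_of_lt_one (norm_nonneg (q ^ 2)) hp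
  induction v with
  | zero =>
    obtain ⟨C, hC0, hC⟩ := exists_norm_chainBeta_zero_le hq
    rw [← (Equiv.funUnique (Fin 1) ℕ).symm.summable_iff]
    refine Summable.of_nonneg_of_le (fun n => norm_nonneg _) (fun n => ?_) (hgeo.mul_right C)
    simp only [Function.comp, multiTerm_one, Equiv.funUnique_symm_apply, uniqueElim_const]
    rw [norm_mul, norm_pow (q ^ 2)]
    exact mul_le_mul (hpow _ _ (Nat.le_mul_of_pos_right _ (Nat.succ_pos _))) (hC _)
      (norm_nonneg _) (by positivity)
  | succ v ih =>
    obtain ⟨C, hC0, hC⟩ := exists_norm_invQPoch_le hp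
    rw [← (Fin.consEquiv fun _ : Fin (v + 2) => ℕ).summable_iff]
    refine Summable.of_nonneg_of_le (fun n => norm_nonneg _) (fun n => ?_)
      ((hgeo.mul_right C).mul_of_nonneg ih (fun a => by positivity) fun n => norm_nonneg _)
    obtain ⟨a, n⟩ := n
    change ‖multiTerm (Nat.succ_pos (v + 1)) q (Fin.cons a n : Fin (v + 2) → ℕ)‖ ≤ _
    rw [multiTerm_cons, norm_mul, norm_mul, norm_pow (q ^ 2)]
    exact mul_le_mul_of_nonneg_right (mul_le_mul
      (hpow _ _ ((Nat.le_add_right a _).trans (Nat.le_mul_of_pos_right _ (Nat.succ_pos _)))) (hC _)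
      (norm_nonneg _) (by positivity)) (norm_nonneg _)

theorem tendsto_chainBeta_multiTerm {q : ℂ} (hq : ‖q‖ < 1) (v : ℕ) :
    Tendsto (fun L : ℕ => chainBeta q (v + 1) L) atTop
      (𝓝 ((∑' n : Fin (v + 1) → ℕ, multiTerm (Nat.succ_pos v) q n) *
        (qPochInf (q ^ 2) (q ^ 2))⁻¹)) := by
  have hp : ‖q ^ 2‖ < 1 := by
    rw [norm_pow]; exact pow_lt_one₀ (norm_nonneg q) hq two_ne_zero
  obtain ⟨C, hC0, hC⟩ := exists_norm_invQPoch_le hp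
  rw [← tsum_mul_right]
  refine (tendsto_tsum_of_dominated_convergence ((summable_norm_multiTerm hq v).mul_right C)
    (fun n => (tendsto_invQPoch hp (-(tailSum n 0 : ℤ))).const_mul _)
    (Eventually.of_forall fun L n => ?_)).congr fun L => (hasSum_multiTerm_mul v L q).tsum_eq
  rw [norm_mul]
  gcongr
  exact hC _

theorem norm_legendreSym_three_le (n : ℤ) : ‖(legendreSym 3 n : ℂ)‖ ≤ 1 := by
  obtain ⟨m, h | h | h⟩ : ∃ m, n = 3 * m ∨ n = 3 * m + 1 ∨ n = 3 * m + 2 :=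
    ⟨n / 3, by omega⟩
  · rw [h, legendreSym_three_mul]; simp
  · rw [h, legendreSym_three_mul_add_one]; simp
  · rw [h, legendreSym_three_mul_add_two]; simp

theorem tendsto_chainBeta_quintQ {q : ℂ} (hq0 : q ≠ 0) (hq : ‖q‖ < 1) (v : ℕ) :
    Tendsto (fun L : ℕ => chainBeta q v L) atTop
      (𝓝 (quintQ (q ^ (12 * v + 6)) q *
        ((qPochInf (q ^ 2) (q ^ 2))⁻¹ * (qPochInf (q ^ 2) (q ^ 2))⁻¹))) := by
  have hp : ‖q ^ 2‖ < 1 := by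
    rw [norm_pow]; exact pow_lt_one₀ (norm_nonneg q) hq two_ne_zero
  obtain ⟨C, hC0, hC⟩ := exists_norm_invQPoch_le hp
  have hu : ‖q ^ (2 * v + 1)‖ < 1 := by
    rw [norm_pow]; exact pow_lt_one₀ (norm_nonneg q) hq (by omega)
  have hQ : HasSum (fun j : ℤ => (-1 : ℂ) ^ j *
      q ^ ((2 * (v : ℤ) + 1) * j ^ 2 - 2 * (v : ℤ) * j) * (legendreSym 3 (j + 1) : ℂ))
      (quintQ (q ^ (12 * v + 6)) q) := by
    -- The choice `u = q^{2v+1}`, `z = q` gives `(2v+1)(j² - j) + j = (2v+1)j² - 2vj` and `u⁶ =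
    -- q^{12v+6}`.
    refine (hasSum_quintuple (pow_ne_zero (2 * v + 1) hq0) hu hq0).of_eq (fun j => ?_) ?_
    · rw [mul_right_comm, ← zpow_natCast q, ← zpow_mul, ← zpow_add₀ hq0]
      congr 3; push_cast; ring
    · rw [← pow_mul]; congr 2; ring
  have hr : Summable fun j : ℤ =>
      ‖(q ^ (-(2 * (v : ℤ)))) ^ j * (q ^ (2 * v + 1)) ^ (j ^ 2)‖ := by
    simpa only [norm_mul, norm_zpow (q ^ (-(2 * (v : ℤ)))), norm_zpow (q ^ (2 * v + 1))] using
      summable_zpow_mul_zpow_sq (norm_pos_iff.2 (zpow_ne_zero (-(2 * (v : ℤ))) hq0))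
        (norm_pos_iff.2 (pow_ne_zero (2 * v + 1) hq0)) hu
  rw [← hQ.tsum_eq, ← tsum_mul_right]
  refine (tendsto_tsum_of_dominated_convergence (hr.mul_right (C * C)) (fun j => ?_)
    (Eventually.of_forall fun L j => ?_)).congr fun L =>
      (hasSum_chainTerm hq0 (pow_ne_one_of_norm_lt_one hq) v L).tsum_eq
  · refine Tendsto.const_mul _ ((tendsto_invQPoch hp j).mul
      ((tendsto_invQPoch hp (1 - j)).congr fun L => ?_))
    rw [add_sub_assoc]
  · have e : q ^ ((2 * (v : ℤ) + 1) * j ^ 2 - 2 * (v : ℤ) * j) =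
        (q ^ (-(2 * (v : ℤ)))) ^ j * (q ^ (2 * v + 1)) ^ (j ^ 2) := by
      rw [← zpow_natCast q (2 * v + 1), ← zpow_mul, ← zpow_mul, ← zpow_add₀ hq0]
      congr 1; push_cast; ring
    have h1 : ‖(-1 : ℂ) ^ j‖ = 1 := by rw [norm_zpow, norm_neg, norm_one, one_zpow]
    rw [chainTerm, e, norm_mul, norm_mul, norm_mul, h1, one_mul, norm_mul (invQPoch _ _)]
    have h2 := mul_le_mul (hC (L + j)) (hC (L + 1 - j)) (norm_nonneg _) hC0
    exact mul_le_mul (mul_le_of_le_one_right (norm_nonneg _) (norm_legendreSym_three_le _)) h2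
      (by positivity) (norm_nonneg _)

theorem hasSum_multiTerm {v : ℕ} (hv : 1 ≤ v) {q : ℂ} (hq0 : 0 < ‖q‖) (hq : ‖q‖ < 1) :
    HasSum (fun n : Fin v → ℕ => multiTerm hv q n)
      (quintQ (q ^ (12 * v + 6)) q / qPochInf (q ^ 2) (q ^ 2)) := by
  obtain ⟨v, rfl⟩ : ∃ k, v = k + 1 := ⟨v - 1, by omega⟩
  have hp : ‖q ^ 2‖ < 1 := by
    rw [norm_pow]; exact pow_lt_one₀ (norm_nonneg q) hq two_ne_zero
  have hE := inv_ne_zero (qPochInf_self_ne_zero hp)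
  -- The multisum limit carries one factor `1/(q̃)_∞` and the bilateral limit two, hence the single
  -- one in the result.
  have h := tendsto_nhds_unique (tendsto_chainBeta_multiTerm hq v)
    (tendsto_chainBeta_quintQ (norm_pos_iff.1 hq0) hq (v + 1))
  rw [← mul_assoc] at h
  rw [div_eq_mul_inv, ← mul_right_cancel₀ hE h]
  exact (summable_norm_multiTerm hq v).of_norm.hasSum

end InfiniteHierarchy

theorem mainTheorem9 :
    (∀ (v : ℕ) (hv : 1 ≤ v),
      -- the finite (polynomial) version
      (∀ q : ℂ, (∀ m : ℕ, 1 ≤ m → q ^ m ≠ 1) → ∀ L : ℕ,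
        (Function.support (finiteTerm hv L q)).Finite ∧
        (Function.support (bilateralTerm v L q)).Finite ∧
        ∑ᶠ n : Fin v → ℕ, finiteTerm hv L q n = ∑ᶠ j : ℤ, bilateralTerm v L q j) ∧
      -- the hierarchy of infinite series
      (∀ q : ℂ, 0 < ‖q‖ → ‖q‖ < 1 →
        HasSum (fun n : Fin v → ℕ => multiTerm hv q n)
          (quintQ (q ^ (12 * v + 6)) q / qPochInf (q ^ 2) (q ^ 2)))) ∧
    -- the single-sum case `v = 1`
    (∀ q : ℂ, 0 < ‖q‖ → ‖q‖ < 1 →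
      HasSum (fun n : ℕ =>
          (q ^ 2) ^ (n * (n + 1)) * qPoch (q ^ 3) (q ^ 6) n /
            (qPoch (q ^ 2) (q ^ 2) (2 * n) * qPoch q (q ^ 2) (n + 1)))
        (quintQ (q ^ 18) q / qPochInf (q ^ 2) (q ^ 2))) := by
  refine ⟨fun v hv => ⟨fun q hq L => ⟨finite_support_finiteTerm hv L q,
    finite_support_bilateralTerm v L q, finsum_finiteTerm hv hq L⟩,
    fun q hq0 hq => hasSum_multiTerm hv hq0 hq⟩, fun q hq0 hq => ?_⟩
  have h := hasSum_multiTerm (Nat.succ_pos 0) hq0 hq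
  rw [← (Equiv.funUnique (Fin 1) ℕ).symm.hasSum_iff] at h
  refine h.of_eq (fun n => ?_) rfl
  simp only [Function.comp, multiTerm_one, Equiv.funUnique_symm_apply, uniqueElim_const, chainBeta]
  rw [mul_div_assoc]
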